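/- For $z\in\mathbb C$ let $$f_4(z)=\sum_{k=0}^\infty \frac{z^{k+1}}{k!\,(k+1)!}.$$ This series converges for every $z\in\mathbb C$, and $f_4$ is a real entire function (entire, and real on the real axis) which satisfies $z f_4''(z)=f_4(z)$ for all $z\in\mathbb C$. All zeros of $f_4$ and of $f_4'$ are real and non-positive, and the meromorphic function $f_4''/f_4$ (with removable singularities removed) has no zeros in $\mathbb C$. Moreover, every function $y$ which is meromorphic in $\mathbb C$ and solves $z y''(z)=y(z)$ is a constant multiple $y=c f_4$, $c\in\mathbb C$, of $f_4$ (equations between meromorphic functions being understood as identities off a closed discrete subset of $\mathbb C$). -/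

import Mathlib

/-- The function `f₄(z) = ∑ z ^ (k + 1) / (k! (k + 1)!)`, the sum being over all `k ≥ 0`. -/
noncomputable def f₄ (z : ℂ) : ℂ :=
  ∑' k : ℕ, z ^ (k + 1) / ((Nat.factorial k : ℂ) * (Nat.factorial (k + 1) : ℂ))

/-- A real entire function: holomorphic on the whole plane and real on the real axis. -/
def IsRealEntire (f : ℂ → ℂ) : Prop :=
  Differentiable ℂ f ∧ ∀ x : ℝ, (f (x : ℂ)).im = 0

/-- `y` solves `z y''(z) = y(z)` as an identity between meromorphic functions in the plane: the
values at the points of a closed discrete set (for instance at poles, where a function `ℂ → ℂ`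
carries a meaningless value) are disregarded. -/
def IsMeromorphicSolution (y : ℂ → ℂ) : Prop :=
  Meromorphic y ∧ (fun z => z * deriv (deriv y) z) =ᶠ[Filter.codiscrete ℂ] y

/-- The meromorphic function `g` has no zeros. A zero of a meromorphic function is a point at
which its order (computed from the punctured neighbourhood, so that removable singularities are
removed) is positive; the order is `⊤` where the function vanishes identically nearby. -/
def HasNoMeromorphicZeros (g : ℂ → ℂ) : Prop :=
  Meromorphic g ∧ ∀ z : ℂ, ¬ 0 < meromorphicOrderAt g z

open Filter Topology ComplexConjugate

/-! Everything rests on `f₄ = z f₄''` and `f₄''(0) = 1`. For the zeros, differentiating `w z f₄'(zt)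
conj (f₄ (zt))` in `t` and using the equation gives a combination of `|f₄''|²` and `|f₄'|²`. Off the
ray `(-∞, 0]` some `w` makes its real part nonnegative, so a zero of `f₄` or `f₄'` at `z` would
force `f₄'' = 0` along the segment from `0` to `z` (`im_eq_zero_and_re_nonpos_of_f₄Deriv_mul_f₄`).
For uniqueness, comparing orders at `0` allows only order `1` or `⊤`
(`meromorphicOrderAt_eq_one_or_top`); subtracting the right multiple of `f₄` rules out order `1`,
and the identity theorem finishes. -/

/-- A series `∑ a k * z ^ (k + 1)` with `‖(k + 1) * a k‖ ≤ 1 / k!` may be differentiated termwise. -/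
lemma hasDerivAt_tsum_mul_pow_succ {a b : ℕ → ℂ} (hb : ∀ k, b k = a k * (k + 1))
    (hle : ∀ k, ‖b k‖ ≤ 1 / (Nat.factorial k : ℝ)) (z : ℂ) :
    HasDerivAt (fun z => ∑' k, a k * z ^ (k + 1)) (∑' k, b k * z ^ k) z := by
  refine hasDerivAt_tsum_of_isPreconnected (u := fun k => (‖z‖ + 1) ^ k / (Nat.factorial k : ℝ))
    (t := Metric.ball 0 (‖z‖ + 1)) (y₀ := 0) (Real.summable_pow_div_factorial _) Metric.isOpen_ball
    (convex_ball _ _).isPreconnected (g := fun k z => a k * z ^ (k + 1))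
    (g' := fun k z => b k * z ^ k) ?_ ?_ ?_ ?_ ?_
  · intro k y _
    have := (hasDerivAt_pow (k + 1) y).const_mul (a k)
    refine this.congr_deriv ?_
    rw [hb, Nat.add_sub_cancel]
    push_cast
    ring
  · intro k y hy
    have hy' : ‖y‖ ≤ ‖z‖ + 1 := by simpa using (Metric.mem_ball.1 hy).le
    calc ‖b k * y ^ k‖ = ‖b k‖ * ‖y‖ ^ k := by rw [norm_mul, norm_pow]
      _ ≤ 1 / (Nat.factorial k : ℝ) * (‖z‖ + 1) ^ k := by
        gcongr
        exact hle k
      _ = _ := by ring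
  · simp; positivity
  · simp
  · simp

/-- The series representing the derivative of `f₄`. -/
noncomputable def f₄Deriv (z : ℂ) : ℂ :=
  ∑' k : ℕ, 1 / ((Nat.factorial k : ℂ) * (Nat.factorial k : ℂ)) * z ^ k

/-- The series representing the second derivative of `f₄`. -/
noncomputable def f₄Deriv₂ (z : ℂ) : ℂ :=
  ∑' k : ℕ, 1 / ((Nat.factorial k : ℂ) * (Nat.factorial (k + 1) : ℂ)) * z ^ k

lemma norm_one_div_factorial_mul_le (k m : ℕ) :
    ‖1 / ((Nat.factorial k : ℂ) * (Nat.factorial m : ℂ))‖ ≤ 1 / (Nat.factorial k : ℝ) := by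
  rw [norm_div, norm_mul, norm_one, Complex.norm_natCast, Complex.norm_natCast]
  have h1 : (1 : ℝ) ≤ Nat.factorial m := by exact_mod_cast Nat.factorial_pos m
  have h2 : (0 : ℝ) < Nat.factorial k := by exact_mod_cast Nat.factorial_pos k
  exact one_div_le_one_div_of_le h2 (le_mul_of_one_le_right h2.le h1)

lemma summable_one_div_factorial_mul_pow (m : ℕ → ℕ) (z : ℂ) :
    Summable fun k : ℕ =>
      1 / ((Nat.factorial k : ℂ) * (Nat.factorial (m k) : ℂ)) * z ^ k := by
  refine Summable.of_norm_bounded (Real.summable_pow_div_factorial ‖z‖) fun k => ?_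
  rw [norm_mul, norm_pow, mul_comm, div_eq_mul_one_div (_ ^ k)]
  exact mul_le_mul_of_nonneg_left (norm_one_div_factorial_mul_le _ _) (by positivity)

lemma f₄_eq_mul (z : ℂ) : f₄ z = z * f₄Deriv₂ z := by
  rw [f₄, f₄Deriv₂, ← tsum_mul_left]
  exact tsum_congr fun k => by ring

lemma hasSum_f₄ (z : ℂ) : HasSum
    (fun k : ℕ => z ^ (k + 1) / ((Nat.factorial k : ℂ) * (Nat.factorial (k + 1) : ℂ))) (f₄ z) := by
  refine Summable.hasSum ?_
  refine ((summable_one_div_factorial_mul_pow (fun k => k + 1) z).mul_left z).congr fun k => ?_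
  ring

lemma hasDerivAt_f₄ (z : ℂ) : HasDerivAt f₄ (f₄Deriv z) z := by
  have h := hasDerivAt_tsum_mul_pow_succ
    (a := fun k => 1 / ((Nat.factorial k : ℂ) * (Nat.factorial (k + 1) : ℂ)))
    (b := fun k => 1 / ((Nat.factorial k : ℂ) * (Nat.factorial k : ℂ))) (fun k => ?_)
    (fun k => norm_one_div_factorial_mul_le _ _) z
  · refine h.congr_of_eventuallyEq (.of_forall fun y => tsum_congr fun k => ?_)
    ring
  · have := Nat.cast_add_one_ne_zero (R := ℂ) k
    have := Nat.cast_ne_zero (R := ℂ).2 (Nat.factorial_ne_zero k)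
    rw [Nat.factorial_succ]
    push_cast
    field_simp

lemma hasDerivAt_f₄Deriv (z : ℂ) : HasDerivAt f₄Deriv (f₄Deriv₂ z) z := by
  have h := hasDerivAt_tsum_mul_pow_succ
    (a := fun k => 1 / ((Nat.factorial (k + 1) : ℂ) * (Nat.factorial (k + 1) : ℂ)))
    (b := fun k => 1 / ((Nat.factorial k : ℂ) * (Nat.factorial (k + 1) : ℂ))) (fun k => ?_)
    (fun k => norm_one_div_factorial_mul_le _ _) z
  · refine (h.const_add 1).congr_of_eventuallyEq (.of_forall fun y => ?_)
    rw [f₄Deriv, (summable_one_div_factorial_mul_pow (fun k => k) y).tsum_eq_zero_add]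
    simp
  · have := Nat.cast_add_one_ne_zero (R := ℂ) k
    have := Nat.cast_ne_zero (R := ℂ).2 (Nat.factorial_ne_zero k)
    rw [Nat.factorial_succ]
    push_cast
    field_simp

lemma deriv_f₄ : deriv f₄ = f₄Deriv := funext fun z => (hasDerivAt_f₄ z).deriv

lemma deriv_deriv_f₄ : deriv (deriv f₄) = f₄Deriv₂ := by
  rw [deriv_f₄]
  exact funext fun z => (hasDerivAt_f₄Deriv z).deriv

lemma differentiable_f₄ : Differentiable ℂ f₄ := fun z => (hasDerivAt_f₄ z).differentiableAt

lemma analyticAt_f₄ (z : ℂ) : AnalyticAt ℂ f₄ z := differentiable_f₄.analyticAt z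

lemma analyticAt_f₄Deriv₂ (z : ℂ) : AnalyticAt ℂ f₄Deriv₂ z :=
  deriv_deriv_f₄ ▸ (analyticAt_f₄ z).deriv.deriv

lemma f₄Deriv₂_zero : f₄Deriv₂ 0 = 1 := by
  rw [f₄Deriv₂, tsum_eq_single 0 fun k hk => by simp [hk]]
  simp

lemma isRealEntire_f₄ : IsRealEntire f₄ := by
  refine ⟨differentiable_f₄, fun x => ?_⟩
  refine (Complex.hasSum_im (hasSum_f₄ x)).unique ?_
  convert hasSum_zero using 2 with k
  norm_cast

/-- The real part of `w z f₄'(z t) conj (f₄ (z t))` along the segment from `0` to `z`. -/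
lemma hasDerivAt_re_f₄Deriv_mul_conj (w z : ℂ) (t : ℝ) :
    HasDerivAt (fun s : ℝ => (w * z * f₄Deriv (z * s) * conj (f₄ (z * s))).re)
      (Complex.normSq z * ((w * z).re * (t * Complex.normSq (f₄Deriv₂ (z * t)))
        + w.re * Complex.normSq (f₄Deriv (z * t)))) t := by
  have hz : HasDerivAt (fun s : ℂ => z * s) z (t : ℂ) := by
    simpa using (hasDerivAt_id (t : ℂ)).const_mul z
  have h0 : HasDerivAt (fun s : ℝ => f₄ (z * s)) (f₄Deriv (z * t) * z) t :=
    ((hasDerivAt_f₄ (z * t)).comp (t : ℂ) hz).comp_ofReal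
  have h1 : HasDerivAt (fun s : ℝ => f₄Deriv (z * s)) (f₄Deriv₂ (z * t) * z) t :=
    ((hasDerivAt_f₄Deriv (z * t)).comp (t : ℂ) hz).comp_ofReal
  have h := Complex.reCLM.hasFDerivAt.comp_hasDerivAt t ((h1.const_mul (w * z)).mul h0.star)
  refine h.congr_deriv ?_
  simp only [f₄_eq_mul (z * t), Complex.reCLM_apply, Complex.star_def, map_mul,
    Complex.conj_ofReal]
  simp only [Complex.normSq_apply, Complex.mul_re, Complex.mul_im, Complex.add_re,
    Complex.conj_re, Complex.conj_im, Complex.ofReal_re, Complex.ofReal_im]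
  ring

lemma im_eq_zero_and_re_nonpos_of_f₄Deriv_mul_f₄ {z : ℂ} (h : f₄Deriv z * conj (f₄ z) = 0) :
    z.im = 0 ∧ z.re ≤ 0 := by
  by_contra hz
  -- The coefficient `w.re` may vanish, so a quarter turn of `z` towards the right half-plane
  -- suffices.
  obtain ⟨w, hw, hwz⟩ : ∃ w : ℂ, 0 ≤ w.re ∧ 0 < (w * z).re := by
    rcases lt_trichotomy z.im 0 with hi | hi | hi
    · exact ⟨Complex.I, by simp, by simpa using hi⟩
    · exact ⟨1, by simp, by simpa using not_le.1 fun hr => hz ⟨hi, hr⟩⟩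
    · exact ⟨-Complex.I, by simp, by simpa using hi⟩
  have hz0 : 0 < Complex.normSq z := Complex.normSq_pos.2 fun h0 => by simp [h0] at hwz
  set H : ℝ → ℝ := fun s : ℝ => (w * z * f₄Deriv (z * s) * conj (f₄ (z * s))).re with hH
  have hd := hasDerivAt_re_f₄Deriv_mul_conj w z
  have hmono : MonotoneOn H (Set.Icc 0 1) := by
    refine monotoneOn_of_deriv_nonneg (convex_Icc 0 1)
      (fun t _ => (hd t).continuousAt.continuousWithinAt)
      (fun t _ => (hd t).differentiableAt.differentiableWithinAt) fun t ht => ?_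
    rw [interior_Icc] at ht
    rw [(hd t).deriv]
    have := Complex.normSq_nonneg (f₄Deriv₂ (z * t))
    have := Complex.normSq_nonneg (f₄Deriv (z * t))
    have := ht.1.le
    positivity
  have hH0 : H 0 = 0 := by simp [hH, f₄_eq_mul 0]
  have hH1 : H 1 = 0 := by
    simp only [hH, Complex.ofReal_one, mul_one]
    rw [mul_assoc (w * z), h, mul_zero, Complex.zero_re]
  -- A monotone `H` with equal end values is constant, so both nonnegative terms of its derivative
  -- vanish.
  have hzero : ∀ t ∈ Set.Ioo (0 : ℝ) 1, f₄Deriv₂ (z * t) = 0 := by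
    intro t ht
    have hev : H =ᶠ[𝓝 t] fun _ => 0 := by
      filter_upwards [Ioo_mem_nhds ht.1 ht.2] with s hs
      have hs' := Set.Ioo_subset_Icc_self hs
      exact le_antisymm (hH1 ▸ hmono hs' (by simp) hs'.2) (hH0 ▸ hmono (by simp) hs' hs'.1)
    have h0 := (hd t).deriv.symm.trans (hev.deriv_eq.trans (deriv_const t (0 : ℝ)))
    by_contra hne
    have h2 : 0 < Complex.normSq (f₄Deriv₂ (z * t)) := Complex.normSq_pos.2 hne
    have h3 := Complex.normSq_nonneg (f₄Deriv (z * t))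
    have h4 := ht.1
    have : 0 < Complex.normSq z * ((w * z).re * (t * Complex.normSq (f₄Deriv₂ (z * t)))
        + w.re * Complex.normSq (f₄Deriv (z * t))) := by positivity
    exact this.ne' h0
  have hc : Tendsto (fun t : ℝ => f₄Deriv₂ (z * t)) (𝓝[>] 0) (𝓝 1) := by
    have h1 : ContinuousAt (fun t : ℝ => f₄Deriv₂ (z * t)) 0 :=
      ContinuousAt.comp (analyticAt_f₄Deriv₂ _).continuousAt (by fun_prop)
    simpa [ContinuousAt, f₄Deriv₂_zero] using h1.mono_left (nhdsWithin_le_nhds (s := Set.Ioi 0))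
  refine zero_ne_one (tendsto_nhds_unique (tendsto_const_nhds.congr' ?_) hc)
  filter_upwards [Ioo_mem_nhdsGT (zero_lt_one (α := ℝ))] with t ht
  exact (hzero t ht).symm

lemma meromorphicOrderAt_f₄_zero : meromorphicOrderAt f₄ 0 = 1 := by
  refine (meromorphicOrderAt_eq_int_iff (n := 1) (analyticAt_f₄ 0).meromorphicAt).2
    ⟨f₄Deriv₂, analyticAt_f₄Deriv₂ 0, by simp [f₄Deriv₂_zero], .of_forall fun z => ?_⟩
  simpa using f₄_eq_mul z

lemma meromorphic_f₄ : Meromorphic f₄ := fun z => (analyticAt_f₄ z).meromorphicAt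

lemma eventually_f₄_ne_zero (z : ℂ) : ∀ᶠ x in 𝓝[≠] z, f₄ x ≠ 0 := by
  refine (meromorphicOrderAt_ne_top_iff_eventually_ne_zero (meromorphic_f₄ z)).1 ?_
  refine (meromorphic_f₄.meromorphicOn (s := Set.univ)).meromorphicOrderAt_ne_top_of_isPreconnected
    isPreconnected_univ (Set.mem_univ 0) (Set.mem_univ z) ?_
  simp [meromorphicOrderAt_f₄_zero]

/-- The quotient is `1 / x` away from isolated points, so its product with `x` cannot tend to `0`.
-/
lemma hasNoMeromorphicZeros_deriv_deriv_f₄_div :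
    HasNoMeromorphicZeros (fun z => deriv (deriv f₄) z / f₄ z) := by
  refine ⟨meromorphic_f₄.deriv.deriv.div meromorphic_f₄, fun z hz => ?_⟩
  have h0 := (tendsto_zero_of_meromorphicOrderAt_pos hz).mul
    (tendsto_id.mono_left nhdsWithin_le_nhds : Tendsto id (𝓝[≠] z) (𝓝 z))
  rw [zero_mul] at h0
  refine one_ne_zero (tendsto_nhds_unique (tendsto_const_nhds.congr' ?_) h0)
  filter_upwards [eventually_f₄_ne_zero z] with x hx
  rw [deriv_deriv_f₄, id, div_mul_eq_mul_div, mul_comm, ← f₄_eq_mul, div_self hx]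

/-- A local meromorphic solution of `z y'' = y` at the origin has a simple zero there or vanishes
identically. -/
lemma meromorphicOrderAt_eq_one_or_top {y : ℂ → ℂ} (hy : MeromorphicAt y 0)
    (h : (fun z => z * deriv (deriv y) z) =ᶠ[𝓝[≠] 0] y) :
    meromorphicOrderAt y 0 = 1 ∨ meromorphicOrderAt y 0 = ⊤ := by
  cases hn : meromorphicOrderAt y 0 with
  | top => exact .inr rfl
  | coe n =>
    left
    by_contra hn1
    have hn1 : n ≠ 1 := fun h => hn1 (by simp [h])
    have hmul : meromorphicOrderAt y 0 = 1 + meromorphicOrderAt (deriv (deriv y)) 0 := by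
      rw [← meromorphicOrderAt_congr h, ← meromorphicOrderAt_id (𝕜 := ℂ)]
      exact meromorphicOrderAt_mul (f := id) (analyticAt_id.meromorphicAt) hy.deriv.deriv
    -- Differentiation lowers the order by one except at order `0`; there `y''` extends
    -- holomorphically, so `z y''` has order at least `1`.
    rcases eq_or_ne n 0 with rfl | hn0
    · obtain ⟨g, hg, hyg⟩ := hy.meromorphicOrderAt_nonneg_iff.1 hn.ge
      have hd : deriv (deriv y) =ᶠ[𝓝[≠] 0] deriv (deriv g) := hyg.nhdsNE_deriv.nhdsNE_deriv
      rw [meromorphicOrderAt_congr hd, hn] at hmul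
      have := hg.deriv.deriv.meromorphicOrderAt_nonneg
      have : (1 : WithTop ℤ) ≤ 0 := by
        simpa [← hmul] using add_le_add_right this 1
      exact absurd this (by decide)
    · have h1 := meromorphicOrderAt_deriv_eq_sub_one (n := n) (by exact_mod_cast hn0) hn
      have h2 := meromorphicOrderAt_deriv_eq_sub_one (n := n - 1)
        (by exact_mod_cast sub_ne_zero.2 hn1) h1
      rw [h2, hn] at hmul
      have : n = 1 + (n - 1 - 1) := by exact_mod_cast hmul
      omega

lemma exists_eq_const_mul_f₄ {y : ℂ → ℂ} (hy : IsMeromorphicSolution y) :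
    ∃ c : ℂ, y =ᶠ[codiscrete ℂ] fun z => c * f₄ z := by
  obtain ⟨hm, he⟩ := hy
  have he0 : (fun z => z * deriv (deriv y) z) =ᶠ[𝓝[≠] 0] y := by
    have h := mem_codiscrete.1 he 0
    rwa [disjoint_principal_right, compl_compl] at h
  obtain ⟨c, hc⟩ : ∃ c, Tendsto (y / f₄) (𝓝[≠] 0) (𝓝 c) := by
    refine tendsto_nhds_of_meromorphicOrderAt_nonneg ((hm 0).div (meromorphic_f₄ 0)) ?_
    rw [meromorphicOrderAt_div (hm 0) (meromorphic_f₄ 0), meromorphicOrderAt_f₄_zero]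
    rcases meromorphicOrderAt_eq_one_or_top (hm 0) he0 with h | h <;> rw [h]
    · decide
    · exact le_top
  refine ⟨c, ?_⟩
  -- `k` solves the same equation and `k / f₄` tends to `0`, so its order at `0` exceeds `1`, hence
  -- is `⊤`.
  set k : ℂ → ℂ := fun z => y z - c * f₄ z with hk
  have hkm : Meromorphic k := hm.sub ((Meromorphic.const c).mul meromorphic_f₄)
  have hke : (fun z => z * deriv (deriv k) z) =ᶠ[𝓝[≠] 0] k := by
    have han : ∀ᶠ z in 𝓝[≠] (0 : ℂ), AnalyticAt ℂ y z := (hm 0).eventually_analyticAt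
    have hd1 : deriv k =ᶠ[𝓝[≠] 0] fun z => deriv y z - c * deriv f₄ z := by
      filter_upwards [han] with z hz
      rw [hk, deriv_fun_sub hz.differentiableAt ((differentiable_f₄ z).const_mul c),
        deriv_const_mul_field]
    filter_upwards [han, hd1.nhdsNE_deriv, he0] with z hz hd he
    rw [hd, deriv_fun_sub hz.deriv.differentiableAt
      ((analyticAt_f₄ z).deriv.differentiableAt.const_mul c), deriv_const_mul_field]
    simp only [hk]
    rw [← he, deriv_deriv_f₄, f₄_eq_mul]
    ring
  have hkt : Tendsto (k / f₄) (𝓝[≠] 0) (𝓝 0) := by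
    have h := hc.sub_const c
    rw [sub_self] at h
    refine h.congr' ?_
    filter_upwards [eventually_f₄_ne_zero 0] with z hz
    simp only [Pi.div_apply, hk]
    field_simp
  have hktop : meromorphicOrderAt k 0 = ⊤ := by
    refine (meromorphicOrderAt_eq_one_or_top (hkm 0) hke).resolve_left fun h1 => ?_
    have := (tendsto_zero_iff_meromorphicOrderAt_pos ((hkm 0).div (meromorphic_f₄ 0))).1 hkt
    rw [meromorphicOrderAt_div (hkm 0) (meromorphic_f₄ 0), meromorphicOrderAt_f₄_zero, h1] at this
    exact absurd this (by decide)
  have hall : ∀ z, meromorphicOrderAt k z = ⊤ := by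
    intro z
    by_contra hz
    exact (hkm.meromorphicOn (s := Set.univ)).meromorphicOrderAt_ne_top_of_isPreconnected
      isPreconnected_univ (Set.mem_univ z) (Set.mem_univ 0) hz hktop
  refine mem_codiscrete.2 fun z => ?_
  rw [disjoint_principal_right, compl_compl]
  filter_upwards [meromorphicOrderAt_eq_top_iff.1 (hall z)] with x hx
  exact sub_eq_zero.1 hx

theorem mainTheorem5 :
    -- the series converges everywhere, with sum `f₄`, and `f₄` is a real entire function
    (∀ z : ℂ, HasSum
      (fun k : ℕ => z ^ (k + 1) / ((Nat.factorial k : ℂ) * (Nat.factorial (k + 1) : ℂ))) (f₄ z)) ∧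
    IsRealEntire f₄ ∧
    -- `f₄` solves the equation at every point of the plane
    (∀ z : ℂ, z * deriv (deriv f₄) z = f₄ z) ∧
    -- all zeros of `f₄` and of its derivative are real and non-positive
    (∀ z : ℂ, f₄ z = 0 → z.im = 0 ∧ z.re ≤ 0) ∧
    (∀ z : ℂ, deriv f₄ z = 0 → z.im = 0 ∧ z.re ≤ 0) ∧
    -- the meromorphic function `f₄'' / f₄` has no zeros
    HasNoMeromorphicZeros (fun z => deriv (deriv f₄) z / f₄ z) ∧
    -- every meromorphic solution is, as a meromorphic function, a constant multiple of `f₄`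
    (∀ y : ℂ → ℂ, IsMeromorphicSolution y →
      ∃ c : ℂ, y =ᶠ[Filter.codiscrete ℂ] fun z => c * f₄ z) := by
  refine ⟨hasSum_f₄, isRealEntire_f₄, fun z => ?_, fun z hz => ?_, fun z hz => ?_,
    hasNoMeromorphicZeros_deriv_deriv_f₄_div, fun y hy => exists_eq_const_mul_f₄ hy⟩
  · rw [deriv_deriv_f₄, f₄_eq_mul]
  · exact im_eq_zero_and_re_nonpos_of_f₄Deriv_mul_f₄ (by simp [hz])
  · exact im_eq_zero_and_re_nonpos_of_f₄Deriv_mul_f₄ (by simp [← deriv_f₄, hz])
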